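/- Let $d\ge 1$. Let $\mathbf N$ be the space of locally finite counting measures on $\mathbb R^d$ with the $\sigma$-algebra generated by the maps $\nu\mapsto\nu(A)$, $A$ Borel; a point process is an $\mathbf N$-valued random element, and its intensity measure is $\alpha_Y(B)=\mathbb E[Y(B)]$. Let $\lambda:\mathbb R^d\to[0,\infty)$ be locally integrable and let $X$ be a Poisson point process with intensity measure $\lambda(x)\,dx$: for pairwise disjoint bounded Borel sets $A_1,\dots,A_k$ the counts $X(A_1),\dots,X(A_k)$ are independent, with $X(A_i)\sim\mathrm{Poisson}\big(\int_{A_i}\lambda(x)\,dx\big)$. Let $r>0$, let $p:\mathbb N_0\to[0,1]$, and let $B(x,r)$ denote the closed Euclidean ball. For $x\in X$ let $n_r(x;X)=\#\big((X\cap B(x,r))\setminus\{x\}\big)$. Give the points of $X$ mutually independent marks $U_x$, uniform on $(0,1)$ and independent of $X$ (that is, of a measurable enumeration of its points), and let $Y=T_r(X)$ be the process of those points $x\in X$ for which $U_x\le p(n_r(x;X))$. Put $$\mu_x(r)=\int_{B(x,r)}\lambda(y)\,dy,\qquad m_p(t)=\mathbb E[p(N_t)],\quad N_t\sim\mathrm{Poisson}(t).$$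 Then $Y$ is a point process, and for every bounded Borel set $B\subset\mathbb R^d$ the function $x\mapsto\lambda(x)\,m_p(\mu_x(r))$ is integrable on $B$ and $$\alpha_Y(B)=\int_B\lambda(x)\,m_p(\mu_x(r))\,dx.$$ In particular, $\alpha_Y$ is absolutely continuous with respect to Lebesgue measure, with density $$\rho_Y(x)=\lambda(x)\,m_p(\mu_x(r))=\lambda(x)\,e^{-\mu_x(r)}\sum_{n=0}^\infty p(n)\frac{\mu_x(r)^n}{n!},\qquad x\in\mathbb R^d,$$ where the series converges for every $x$. -/

import Mathlib

open MeasureTheory ProbabilityTheory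
open scoped ENNReal NNReal

noncomputable section

/-- The space `𝐍` of locally finite counting measures on `ℝᵈ`: measures that take a (finite)
natural number as value on every bounded Borel set.  As a subtype of `Measure`, it carries the
σ-algebra generated by the evaluations `ν ↦ ν A`, `A` Borel. -/
abbrev PointConfiguration (d : ℕ) : Type :=
  {ν : Measure (EuclideanSpace ℝ (Fin d)) //
    ∀ A, MeasurableSet A → Bornology.IsBounded A → ∃ n : ℕ, ν A = n}

namespace PointConfiguration

variable {d : ℕ}

/-- The number of points of `ν` in `A` (with multiplicity), as a natural number. It is the value
`ν A` for bounded Borel `A`, see `count_eq`. -/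
def count (ν : PointConfiguration d) (A : Set (EuclideanSpace ℝ (Fin d))) : ℕ :=
  ⌊(ν.1 A).toReal⌋₊

theorem count_eq (ν : PointConfiguration d) {A : Set (EuclideanSpace ℝ (Fin d))}
    (hA : MeasurableSet A) (hb : Bornology.IsBounded A) : (ν.count A : ℝ≥0∞) = ν.1 A := by
  obtain ⟨n, hn⟩ := ν.2 A hA hb
  simp [count, hn]

/-- The neighbour count `n_r(x; ν)`: the number of points of `ν` other than `x` in the closed
ball `B(x, r)`. -/
def neighbourCount (r : ℝ) (x : EuclideanSpace ℝ (Fin d)) (ν : PointConfiguration d) : ℕ :=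
  ν.count (Metric.closedBall x r \ {x})

end PointConfiguration

/-- `X` is a Poisson point process on `ℝᵈ` with intensity measure `Λ`: a random element of the
space of locally finite counting measures, with `X(A) ∼ Poisson(Λ(A))` for bounded Borel `A`, and
with `X(A₁), …, X(Aₖ)` independent for pairwise disjoint bounded Borel sets. -/
structure IsPoissonProcess {d : ℕ} {Ω : Type*} [MeasurableSpace Ω] (P : Measure Ω)
    (X : Ω → PointConfiguration d) (Λ : Measure (EuclideanSpace ℝ (Fin d))) : Prop where
  measurable : Measurable X
  law : ∀ A, MeasurableSet A → Bornology.IsBounded A →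
    ∃ m : ℝ≥0, Λ A = m ∧ HasLaw (fun ω => (X ω).count A) (poissonMeasure m) P
  indep : ∀ (k : ℕ) (A : Fin k → Set (EuclideanSpace ℝ (Fin d))),
    (∀ i, MeasurableSet (A i)) → (∀ i, Bornology.IsBounded (A i)) →
    Pairwise (fun i j => Disjoint (A i) (A j)) →
    iIndepFun (fun i ω => (X ω).count (A i)) P

/-- Independent uniform marking of a point process `X`: the points of `X` are enumerated
measurably as `point k`, `k < card` (`card ∈ {0, 1, …, ∞}` is the total number of points), and the
`k`-th point carries the mark `mark k`; the marks are mutually independent, uniform on `(0, 1)`,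
and independent of the enumerated points. -/
structure UniformMarking {d : ℕ} {Ω : Type*} [MeasurableSpace Ω] (P : Measure Ω)
    (X : Ω → PointConfiguration d) where
  card : Ω → ℕ∞
  point : ℕ → Ω → EuclideanSpace ℝ (Fin d)
  mark : ℕ → Ω → ℝ
  measurable_card : Measurable card
  measurable_point : ∀ k, Measurable (point k)
  measurable_mark : ∀ k, Measurable (mark k)
  eq_sum : ∀ ω, (X ω).1 =
    Measure.sum fun k : {k : ℕ // (k : ℕ∞) < card ω} => Measure.dirac (point k ω)
  law_mark : ∀ k, HasLaw (mark k) (volume.restrict (Set.Ioo (0 : ℝ) 1)) P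
  iIndepFun_mark : iIndepFun mark P
  indepFun : IndepFun (fun ω => (card ω, fun k => point k ω)) (fun ω k => mark k ω) P

namespace UniformMarking

variable {d : ℕ} {Ω : Type*} [MeasurableSpace Ω] {P : Measure Ω} {X : Ω → PointConfiguration d}

/-- The index `k` is that of a retained point: it belongs to a point `x` of `X`, and the mark of
this point is at most `p (n_r(x; X))`. -/
def Retained (M : UniformMarking P X) (r : ℝ) (p : ℕ → ℝ) (ω : Ω) (k : ℕ) : Prop :=
  (k : ℕ∞) < M.card ω ∧ M.mark k ω ≤ p ((X ω).neighbourCount r (M.point k ω))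

/-- The sum of the Dirac measures at the retained points. -/
def thinningMeasure (M : UniformMarking P X) (r : ℝ) (p : ℕ → ℝ) (ω : Ω) :
    Measure (EuclideanSpace ℝ (Fin d)) :=
  Measure.sum fun k : {k : ℕ // M.Retained r p ω k} => Measure.dirac (M.point k ω)

theorem thinningMeasure_mem (M : UniformMarking P X) (r : ℝ) (p : ℕ → ℝ) (ω : Ω)
    (A : Set (EuclideanSpace ℝ (Fin d))) (hA : MeasurableSet A) (hb : Bornology.IsBounded A) :
    ∃ n : ℕ, M.thinningMeasure r p ω A = n := by
  have hle : M.thinningMeasure r p ω A ≤ (X ω).1 A := by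
    rw [M.eq_sum ω, thinningMeasure, Measure.sum_apply _ hA, Measure.sum_apply _ hA]
    let g : {k : ℕ // M.Retained r p ω k} → {k : ℕ // (k : ℕ∞) < M.card ω} :=
      fun k => ⟨k.1, k.2.1⟩
    have hg : Function.Injective g := fun a b h => by
      simpa [g, Subtype.ext_iff] using h
    exact ENNReal.tsum_comp_le_tsum_of_injective hg
      (fun k => Measure.dirac (M.point k.1 ω) A)
  obtain ⟨n, hn⟩ := (X ω).2 A hA hb
  have hfin : M.thinningMeasure r p ω A ≠ ∞ :=
    ne_top_of_le_ne_top (by rw [hn]; exact ENNReal.natCast_ne_top n) hle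
  have heq : M.thinningMeasure r p ω A
      = (Set.encard {k : {k : ℕ // M.Retained r p ω k} | M.point k ω ∈ A} : ℕ∞) := by
    rw [thinningMeasure, Measure.sum_apply _ hA, ← ENNReal.tsum_set_one,
      tsum_subtype {k : {k : ℕ // M.Retained r p ω k} | M.point k ω ∈ A} fun _ => (1 : ℝ≥0∞)]
    refine tsum_congr fun k => ?_
    rw [Measure.dirac_apply' _ hA]
    rfl
  rw [heq] at hfin ⊢
  generalize Set.encard _ = e at hfin ⊢
  cases e with
  | top => exact absurd rfl hfin
  | coe m => exact ⟨m, rfl⟩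

/-- The neighbour-count dependent thinning `T_r(X)`, the configuration of the retained points. -/
def thinning (M : UniformMarking P X) (r : ℝ) (p : ℕ → ℝ) (ω : Ω) : PointConfiguration d :=
  ⟨M.thinningMeasure r p ω, M.thinningMeasure_mem r p ω⟩

end UniformMarking

/-- The intensity measure `α_Y` of a point process `Y`, that is `B ↦ 𝔼[Y(B)]`, see
`intensityMeasure_apply`. -/
def intensityMeasure {d : ℕ} {Ω : Type*} [MeasurableSpace Ω] (P : Measure Ω)
    (Y : Ω → PointConfiguration d) : Measure (EuclideanSpace ℝ (Fin d)) :=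
  P.bind fun ω => (Y ω).1

theorem intensityMeasure_apply {d : ℕ} {Ω : Type*} [MeasurableSpace Ω] (P : Measure Ω)
    {Y : Ω → PointConfiguration d} (hY : Measurable Y) {B : Set (EuclideanSpace ℝ (Fin d))}
    (hB : MeasurableSet B) : intensityMeasure P Y B = ∫⁻ ω, (Y ω).1 B ∂P :=
  Measure.bind_apply hB (measurable_subtype_coe.comp hY).aemeasurable

/-- `μ_x(r) = ∫_{B(x, r)} λ(y) dy`, with `B(x, r)` the closed ball. -/
def ballMass {d : ℕ} (lam : EuclideanSpace ℝ (Fin d) → ℝ) (r : ℝ)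
    (x : EuclideanSpace ℝ (Fin d)) : ℝ :=
  ∫ y in Metric.closedBall x r, lam y

/-- `m_p(t) = 𝔼[p(N)]` for `N ∼ Poisson(t)`, `t ≥ 0`. -/
def poissonMean (p : ℕ → ℝ) (t : ℝ) : ℝ :=
  ∫ n, p n ∂(poissonMeasure t.toNNReal)

end

open Filter Topology

/-! Given the enumeration of the points, each mark is uniform, so a point `x` is retained with
probability `p (n_r(x; X))`. Integrating out the marks (`lintegral_thinning_apply`) turns the
expected number of retained points in `B` into the mean of the sum of `p (n_r(x; X))` over the
points of `X` in `B`.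

The Mecke formula for `q (n_r(x; X))` evaluates this mean. It is proved by discretisation: space is
cut into small cells, and for centres in one cell the punctured ball is replaced by one fixed ring
disjoint from that cell. Independence of the counts in cell and ring gives the formula exactly at
each level (`lintegral_setLIntegral_comp_count_cellRing`). As the cells shrink, the ring counts
become equal to the neighbour counts, and dominated convergence passes to the limit.

Finally, the intensity measure has no atoms for `d ≥ 1`, so the count in the punctured ball at a
fixed `x` is Poisson with mean `μ_x(r)`, and the inner expectation is `m_p(μ_x(r))`. -/

/-! ### Poisson mean and uniform marks -/

theorem lintegral_natCast_poissonMeasure (m : ℝ≥0) :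
    ∫⁻ n, (n : ℝ≥0∞) ∂(poissonMeasure m) = m := by
  rw [lintegral_countable']
  simp_rw [poissonMeasure_singleton]
  rw [tsum_eq_zero_add' ENNReal.summable]
  -- The size-bias identity of the Poisson weights: the factor `n + 1` cancels against the
  -- factorial.
  have h : ∀ n : ℕ, ((n + 1 : ℕ) : ℝ≥0∞) *
      ENNReal.ofReal (Real.exp (-m) * m ^ (n + 1) / ((n + 1).factorial : ℝ)) =
      m * poissonMeasure m {n} := by
    intro n
    rw [poissonMeasure_singleton, ← ENNReal.ofReal_natCast, ← ENNReal.ofReal_coe_nnreal,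
      ← ENNReal.ofReal_mul (by positivity), ← ENNReal.ofReal_mul (by positivity)]
    congr 1
    rw [Nat.factorial_succ]
    push_cast
    field_simp
    ring
  simp_rw [h, ENNReal.tsum_mul_left]
  have h1 : ∑' n, poissonMeasure m {n} = 1 := by
    have := lintegral_countable' (μ := poissonMeasure m) (fun _ : ℕ => (1 : ℝ≥0∞))
    simpa using this.symm
  simp [h1]

theorem volume_restrict_Ioo_zero_one_Iic {t : ℝ} (ht : t ∈ Set.Icc (0 : ℝ) 1) :
    volume.restrict (Set.Ioo (0 : ℝ) 1) (Set.Iic t) = ENNReal.ofReal t := by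
  rw [Measure.restrict_congr_set Ioo_ae_eq_Ioc, Measure.restrict_apply measurableSet_Iic,
    Set.Iic_inter_Ioc_of_le ht.2, Real.volume_Ioc, sub_zero]

/-- An independent uniform mark that is compared with a threshold `p (n Z)` may be integrated
out. -/
theorem lintegral_indicator_uniform_le {Ω S : Type*} [MeasurableSpace Ω] [MeasurableSpace S]
    {P : Measure Ω} [IsProbabilityMeasure P] {Z : Ω → S} {U : Ω → ℝ} (hZ : Measurable Z)
    (hU : Measurable U) (hlaw : HasLaw U (volume.restrict (Set.Ioo (0 : ℝ) 1)) P)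
    (hind : IndepFun Z U P) {p : ℕ → ℝ} (hp : ∀ n, p n ∈ Set.Icc (0 : ℝ) 1)
    {a : S → ℝ≥0∞} (ha : Measurable a) {n : S → ℕ} (hn : Measurable n) :
    ∫⁻ ω, a (Z ω) * {ω | U ω ≤ p (n (Z ω))}.indicator 1 ω ∂P =
      ∫⁻ ω, a (Z ω) * ENNReal.ofReal (p (n (Z ω))) ∂P := by
  have hpn : Measurable fun s => p (n s) := (measurable_from_nat (f := p)).comp hn
  have hset : MeasurableSet {q : S × ℝ | q.2 ≤ p (n q.1)} :=
    measurableSet_le measurable_snd (hpn.comp measurable_fst)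
  have hg : Measurable fun q : S × ℝ =>
      a q.1 * {q : S × ℝ | q.2 ≤ p (n q.1)}.indicator 1 q :=
    (ha.comp measurable_fst).mul (measurable_one.indicator hset)
  have hmap := (indepFun_iff_map_prod_eq_prod_map_map hZ.aemeasurable hU.aemeasurable).1 hind
  calc ∫⁻ ω, a (Z ω) * {ω | U ω ≤ p (n (Z ω))}.indicator 1 ω ∂P
      = ∫⁻ q, a q.1 * {q : S × ℝ | q.2 ≤ p (n q.1)}.indicator 1 q
          ∂(P.map fun ω => (Z ω, U ω)) := by
        rw [lintegral_map hg (hZ.prodMk hU)]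
        rfl
    _ = ∫⁻ s, ∫⁻ u, a s * (Set.Iic (p (n s))).indicator 1 u
          ∂(volume.restrict (Set.Ioo (0 : ℝ) 1)) ∂(P.map Z) := by
        rw [hmap, hlaw.map_eq, lintegral_prod _ hg.aemeasurable]
        rfl
    _ = ∫⁻ s, a s * ENNReal.ofReal (p (n s)) ∂(P.map Z) := by
        -- As the threshold lies in `[0, 1]`, it is itself the probability that the mark falls below
        -- it.
        refine lintegral_congr fun s => ?_
        rw [lintegral_const_mul _ (measurable_one.indicator measurableSet_Iic),
          lintegral_indicator_one measurableSet_Iic, volume_restrict_Ioo_zero_one_Iic (hp _)]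
    _ = ∫⁻ ω, a (Z ω) * ENNReal.ofReal (p (n (Z ω))) ∂P :=
        lintegral_map (ha.mul hpn.ennreal_ofReal) hZ

/-! ### Shrinking partitions and rings around cells -/

section Cells

variable {d : ℕ}

theorem exists_dist_denseSeq_lt (ε : ℝ) (hε : 0 < ε) (x : EuclideanSpace ℝ (Fin d)) :
    ∃ k, dist x (TopologicalSpace.denseSeq (EuclideanSpace ℝ (Fin d)) k) < ε :=
  (TopologicalSpace.denseRange_denseSeq (EuclideanSpace ℝ (Fin d))).exists_dist_lt x hε

open Classical in
/-- The number of the cell containing `x` in a countable Borel partition of `ℝᵈ` into cells of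
radius `1 / (n + 1)`. -/
noncomputable def cellIndex (n : ℕ) (x : EuclideanSpace ℝ (Fin d)) : ℕ :=
  Nat.find (exists_dist_denseSeq_lt (1 / ((n : ℝ) + 1)) Nat.one_div_pos_of_nat x)

theorem dist_cellIndex_lt (n : ℕ) (x : EuclideanSpace ℝ (Fin d)) :
    dist x (TopologicalSpace.denseSeq _ (cellIndex n x)) < 1 / ((n : ℝ) + 1) := by
  classical
  exact Nat.find_spec (exists_dist_denseSeq_lt (1 / ((n : ℝ) + 1)) Nat.one_div_pos_of_nat x)

theorem measurable_cellIndex (n : ℕ) : Measurable (cellIndex n (d := d)) := by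
  classical
  refine measurable_find _ fun k => ?_
  exact measurableSet_lt (by fun_prop) measurable_const

/-- The `k`-th cell of the `n`-th partition. -/
def cell (n k : ℕ) : Set (EuclideanSpace ℝ (Fin d)) := cellIndex n ⁻¹' {k}

theorem measurableSet_cell (n k : ℕ) : MeasurableSet (cell n k : Set (EuclideanSpace ℝ (Fin d))) :=
  measurable_cellIndex n (measurableSet_singleton k)

/-- A neighbourhood of the `k`-th cell of the `n`-th partition, with the cell itself removed; it
approximates the closed balls of radius `r` punctured at their centre, for centres in the cell. -/
def cellRing (r : ℝ) (n k : ℕ) : Set (EuclideanSpace ℝ (Fin d)) :=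
  Metric.closedBall (TopologicalSpace.denseSeq _ k) (r + 1 / ((n : ℝ) + 1)) \ cell n k

theorem measurableSet_cellRing (r : ℝ) (n k : ℕ) :
    MeasurableSet (cellRing r n k : Set (EuclideanSpace ℝ (Fin d))) :=
  measurableSet_closedBall.diff (measurableSet_cell n k)

theorem isBounded_cellRing (r : ℝ) (n k : ℕ) :
    Bornology.IsBounded (cellRing r n k : Set (EuclideanSpace ℝ (Fin d))) :=
  Metric.isBounded_closedBall.subset Set.sdiff_subset

theorem iUnion_cell (n : ℕ) : ⋃ k, (cell n k : Set (EuclideanSpace ℝ (Fin d))) = Set.univ :=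
  Set.eq_univ_of_forall fun x => Set.mem_iUnion.2 ⟨cellIndex n x, rfl⟩

theorem pairwise_disjoint_cell (n : ℕ) :
    Pairwise (Function.onFun Disjoint fun k => (cell n k : Set (EuclideanSpace ℝ (Fin d)))) :=
  fun _ _ h => Set.disjoint_left.2 fun _ hx hy => h (hx.symm.trans hy)

/-- The bound does not depend on `n`; it supplies the set of finite measure that dominates the rings
in the limit. -/
theorem cellRing_subset (r : ℝ) (n : ℕ) (x : EuclideanSpace ℝ (Fin d)) :
    cellRing r n (cellIndex n x) ⊆ Metric.closedBall x (r + 2) := by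
  intro y hy
  have h1 : dist y (TopologicalSpace.denseSeq _ (cellIndex n x)) ≤ r + 1 / ((n : ℝ) + 1) := hy.1
  have h2 := dist_cellIndex_lt n x
  have h3 : 1 / ((n : ℝ) + 1) ≤ 1 := by
    rw [div_le_one (by positivity)]
    linarith [n.cast_nonneg (α := ℝ)]
  have h4 := dist_triangle_right y x (TopologicalSpace.denseSeq _ (cellIndex n x))
  rw [Metric.mem_closedBall]
  linarith

/-- Enlarging the radius by `1 / (n + 1)` keeps all of the closed ball, its boundary sphere
included. The point `x` always lies in its own cell, another point leaves that cell once `2 / (n +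
1) < dist y x`, and a point outside the ball is excluded once `2 / (n + 1) < dist y x - r`. -/
theorem eventually_mem_cellRing_iff (r : ℝ) (x y : EuclideanSpace ℝ (Fin d)) :
    ∀ᶠ n in atTop, (y ∈ cellRing r n (cellIndex n x) ↔ y ∈ Metric.closedBall x r \ {x}) := by
  have hlim : Tendsto (fun n : ℕ => 2 * (1 / ((n : ℝ) + 1))) atTop (𝓝 0) := by
    simpa using (tendsto_one_div_add_atTop_nhds_zero_nat (𝕜 := ℝ)).const_mul 2
  have key : ∀ n, dist y x ≤ r → y ∈ Metric.closedBall
      (TopologicalSpace.denseSeq (EuclideanSpace ℝ (Fin d)) (cellIndex n x))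
      (r + 1 / ((n : ℝ) + 1)) := fun n h => by
    have h2 := dist_cellIndex_lt n x
    have h4 := dist_triangle y x (TopologicalSpace.denseSeq _ (cellIndex n x))
    rw [Metric.mem_closedBall]
    linarith
  rcases eq_or_ne y x with rfl | hne
  · refine Eventually.of_forall fun n => ?_
    simp [cellRing, cell]
  by_cases hr : dist y x ≤ r
  · filter_upwards [hlim.eventually (gt_mem_nhds (dist_pos.2 hne))] with n hn
    have : y ∉ cell n (cellIndex n x) := fun h => by
      have hy : cellIndex n y = cellIndex n x := h
      have h1 := dist_cellIndex_lt n y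
      have h2 := dist_cellIndex_lt n x
      rw [hy] at h1
      have h4 := dist_triangle_right y x (TopologicalSpace.denseSeq _ (cellIndex n x))
      linarith
    exact iff_of_true ⟨key n hr, this⟩ ⟨hr, hne⟩
  · filter_upwards [hlim.eventually (gt_mem_nhds (sub_pos.2 (not_le.1 hr)))] with n hn
    refine iff_of_false (fun h => ?_) fun h => hr h.1
    have h1 : dist y (TopologicalSpace.denseSeq _ (cellIndex n x)) ≤ r + 1 / ((n : ℝ) + 1) := h.1
    have h2 := dist_cellIndex_lt n x
    have h4 := dist_triangle_right y x (TopologicalSpace.denseSeq _ (cellIndex n x))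
    linarith

theorem setLIntegral_comp_cellIndex (n : ℕ) (μ : Measure (EuclideanSpace ℝ (Fin d)))
    {B : Set (EuclideanSpace ℝ (Fin d))} (hB : MeasurableSet B) (f : ℕ → ℝ≥0∞) :
    ∫⁻ x in B, f (cellIndex n x) ∂μ = ∑' k, μ (B ∩ cell n k) * f k := by
  have h : B = ⋃ k, B ∩ cell n k := by rw [← Set.inter_iUnion, iUnion_cell, Set.inter_univ]
  conv_lhs => rw [h]
  rw [lintegral_iUnion (fun k => hB.inter (measurableSet_cell n k)) (fun i j hij =>
    (pairwise_disjoint_cell n hij).mono Set.inter_subset_right Set.inter_subset_right)]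
  refine tsum_congr fun k => ?_
  rw [setLIntegral_congr_fun (g := fun _ => f k) (hB.inter (measurableSet_cell n k))
    fun x hx => congrArg f hx.2]
  rw [setLIntegral_const, mul_comm]

end Cells

/-! ### Approximation of neighbour counts -/

namespace PointConfiguration

variable {d : ℕ}

theorem measurable_count {A : Set (EuclideanSpace ℝ (Fin d))} (hA : MeasurableSet A) :
    Measurable fun ν : PointConfiguration d => ν.count A :=
  Nat.measurable_floor.comp
    ((Measure.measurable_coe hA).comp measurable_subtype_coe).ennreal_toReal

theorem apply_ne_top (ν : PointConfiguration d) {A : Set (EuclideanSpace ℝ (Fin d))}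
    (hA : MeasurableSet A) (hb : Bornology.IsBounded A) : ν.1 A ≠ ∞ := by
  rw [← ν.count_eq hA hb]
  exact ENNReal.natCast_ne_top _

/-- The measures of the rings converge, and a convergent sequence of integers is eventually
constant. Hence any function of the count passes to the limit. -/
theorem eventually_count_cellRing_eq (r : ℝ) (x : EuclideanSpace ℝ (Fin d))
    (ν : PointConfiguration d) :
    ∀ᶠ n in atTop, ν.count (cellRing r n (cellIndex n x)) = ν.neighbourCount r x := by
  have h := tendsto_measure_of_tendsto_indicator (μ := ν.1) atTop
    (fun n => measurableSet_cellRing r n (cellIndex n x)) measurableSet_closedBall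
    (ν.apply_ne_top measurableSet_closedBall Metric.isBounded_closedBall)
    (Eventually.of_forall fun n => cellRing_subset r n x)
    (fun y => eventually_mem_cellRing_iff r x y)
  have hb : Bornology.IsBounded (Metric.closedBall x r \ {x}) :=
    Metric.isBounded_closedBall.subset Set.sdiff_subset
  have hm : MeasurableSet (Metric.closedBall x r \ {x}) :=
    measurableSet_closedBall.diff (measurableSet_singleton x)
  have h' := (ENNReal.tendsto_toReal (ν.apply_ne_top hm hb)).comp h
  simp_rw [Function.comp_def, ← ν.count_eq hm hb,
    ← ν.count_eq (measurableSet_cellRing _ _ _) (isBounded_cellRing _ _ _),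
    ENNReal.toReal_natCast] at h'
  have h3 := h'.eventually (Metric.ball_mem_nhds _ one_pos)
  filter_upwards [h3] with n hn
  by_contra hne
  exact absurd (Nat.pairwise_one_le_dist hne) (not_le.2 ((Nat.dist_cast_real _ _).symm.trans_lt hn))

end PointConfiguration

namespace PointConfiguration

variable {d : ℕ}

theorem tendsto_comp_count_cellRing (q : ℕ → ℝ≥0∞) (r : ℝ) (x : EuclideanSpace ℝ (Fin d))
    (ν : PointConfiguration d) :
    Tendsto (fun n => q (ν.count (cellRing r n (cellIndex n x)))) atTop
      (𝓝 (q (ν.neighbourCount r x))) :=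
  tendsto_nhds_of_eventually_eq
    ((eventually_count_cellRing_eq r x ν).mono fun _ h => congrArg q h)

theorem measurable_comp_cellIndex (n : ℕ) (f : ℕ → ℝ≥0∞) :
    Measurable fun x : EuclideanSpace ℝ (Fin d) => f (cellIndex n x) :=
  measurable_from_nat.comp (measurable_cellIndex n)

theorem tendsto_setLIntegral_comp_count_cellRing {q : ℕ → ℝ≥0∞} (hq : ∀ n, q n ≤ 1) (r : ℝ)
    {B : Set (EuclideanSpace ℝ (Fin d))} (hB : MeasurableSet B) (hb : Bornology.IsBounded B)
    (ν : PointConfiguration d) :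
    Tendsto (fun n => ∫⁻ x in B, q (ν.count (cellRing r n (cellIndex n x))) ∂ν.1) atTop
      (𝓝 (∫⁻ x in B, q (ν.neighbourCount r x) ∂ν.1)) := by
  refine tendsto_lintegral_of_dominated_convergence (fun _ => 1)
    (fun n => measurable_comp_cellIndex n fun k => q (ν.count (cellRing r n k)))
    (fun n => Eventually.of_forall fun x => hq _) ?_
    (Eventually.of_forall fun x => tendsto_comp_count_cellRing q r x ν)
  simpa using ν.apply_ne_top hB hb

theorem setLIntegral_comp_count_le {q : ℕ → ℝ≥0∞} (hq : ∀ n, q n ≤ 1)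
    (f : EuclideanSpace ℝ (Fin d) → ℕ) (B : Set (EuclideanSpace ℝ (Fin d)))
    (μ : Measure (EuclideanSpace ℝ (Fin d))) :
    ∫⁻ x in B, q (f x) ∂μ ≤ μ B :=
  (lintegral_mono fun _ => hq _).trans (by simp)

end PointConfiguration

/-! ### The Mecke formula -/

namespace IsPoissonProcess

open PointConfiguration

variable {d : ℕ} {Ω : Type*} [MeasurableSpace Ω] {P : Measure Ω} {X : Ω → PointConfiguration d}
  {Λ : Measure (EuclideanSpace ℝ (Fin d))}

theorem apply_ne_top (hX : IsPoissonProcess P X Λ) {A : Set (EuclideanSpace ℝ (Fin d))}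
    (hA : MeasurableSet A) (hb : Bornology.IsBounded A) : Λ A ≠ ∞ := by
  obtain ⟨m, hm, -⟩ := hX.law A hA hb
  simp [hm]

theorem measurable_apply (hX : IsPoissonProcess P X Λ) {A : Set (EuclideanSpace ℝ (Fin d))}
    (hA : MeasurableSet A) : Measurable fun ω => (X ω).1 A :=
  (Measure.measurable_coe hA).comp (measurable_subtype_coe.comp hX.measurable)

theorem measurable_comp_count (hX : IsPoissonProcess P X Λ) (q : ℕ → ℝ≥0∞)
    {A : Set (EuclideanSpace ℝ (Fin d))} (hA : MeasurableSet A) :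
    Measurable fun ω => q ((X ω).count A) :=
  measurable_from_nat.comp ((measurable_count hA).comp hX.measurable)

theorem lintegral_apply (hX : IsPoissonProcess P X Λ) {A : Set (EuclideanSpace ℝ (Fin d))}
    (hA : MeasurableSet A) (hb : Bornology.IsBounded A) : ∫⁻ ω, (X ω).1 A ∂P = Λ A := by
  obtain ⟨m, hm, hlaw⟩ := hX.law A hA hb
  rw [hm, ← lintegral_natCast_poissonMeasure m,
    ← hlaw.lintegral_comp (f := fun n : ℕ => (n : ℝ≥0∞)) (by fun_prop)]
  exact lintegral_congr fun ω => ((X ω).count_eq hA hb).symm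

theorem lintegral_apply_mul (hX : IsPoissonProcess P X Λ) (q : ℕ → ℝ≥0∞)
    {A C : Set (EuclideanSpace ℝ (Fin d))} (hA : MeasurableSet A) (hAb : Bornology.IsBounded A)
    (hC : MeasurableSet C) (hCb : Bornology.IsBounded C) (hAC : Disjoint A C) :
    ∫⁻ ω, (X ω).1 A * q ((X ω).count C) ∂P = Λ A * ∫⁻ ω, q ((X ω).count C) ∂P := by
  have h := hX.indep 2 ![A, C] (by simp [Fin.forall_fin_two, hA, hC])
    (by simp [Fin.forall_fin_two, hAb, hCb])
    (by
      intro i j hij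
      fin_cases i <;> fin_cases j <;> simp_all [hAC.symm])
  have hcast : Measurable fun n : ℕ => (n : ℝ≥0∞) := measurable_from_nat
  have hq : Measurable q := measurable_from_nat
  have h2 := (h.indepFun (i := 0) (j := 1) (by simp)).comp hcast hq
  rw [← hX.lintegral_apply hA hAb, ← lintegral_mul_eq_lintegral_mul_lintegral_of_indepFun''
    (hX.measurable_apply hA).aemeasurable (hX.measurable_comp_count q hC).aemeasurable]
  convert! h2 using 1
  ext ω
  exact ((X ω).count_eq hA hAb).symm

/-- The Mecke formula at level `n`: the integrand is constant on each cell, and it depends only on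
the count in a ring disjoint from the cell, so each summand factors. -/
theorem lintegral_setLIntegral_comp_count_cellRing (hX : IsPoissonProcess P X Λ) (q : ℕ → ℝ≥0∞)
    (r : ℝ) (n : ℕ) {B : Set (EuclideanSpace ℝ (Fin d))} (hB : MeasurableSet B)
    (hb : Bornology.IsBounded B) :
    ∫⁻ ω, ∫⁻ x in B, q ((X ω).count (cellRing r n (cellIndex n x))) ∂(X ω).1 ∂P =
      ∫⁻ x in B, ∫⁻ ω, q ((X ω).count (cellRing r n (cellIndex n x))) ∂P ∂Λ := by
  rw [setLIntegral_comp_cellIndex n Λ hB fun k => ∫⁻ ω, q ((X ω).count (cellRing r n k)) ∂P]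
  simp_rw [fun ω => setLIntegral_comp_cellIndex n (X ω).1 hB
    fun k => q ((X ω).count (cellRing r n k))]
  rw [lintegral_tsum fun k => Measurable.aemeasurable <| Measurable.fun_mul
    (hX.measurable_apply (hB.inter (measurableSet_cell n k)))
    (hX.measurable_comp_count q (measurableSet_cellRing r n k))]
  refine tsum_congr fun k => hX.lintegral_apply_mul q (hB.inter (measurableSet_cell n k))
    (hb.subset Set.inter_subset_left) (measurableSet_cellRing r n k) (isBounded_cellRing r n k) ?_
  exact Set.disjoint_left.2 fun x hx hx' => hx'.2 hx.2

theorem tendsto_lintegral_comp_count_cellRing [IsProbabilityMeasure P]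
    (hX : IsPoissonProcess P X Λ) {q : ℕ → ℝ≥0∞} (hq : ∀ n, q n ≤ 1) (r : ℝ)
    (x : EuclideanSpace ℝ (Fin d)) :
    Tendsto (fun n => ∫⁻ ω, q ((X ω).count (cellRing r n (cellIndex n x))) ∂P) atTop
      (𝓝 (∫⁻ ω, q ((X ω).neighbourCount r x) ∂P)) :=
  tendsto_lintegral_of_dominated_convergence (fun _ => 1)
    (fun n => hX.measurable_comp_count q (measurableSet_cellRing r n _))
    (fun n => Eventually.of_forall fun ω => hq _) (by simp)
    (Eventually.of_forall fun ω => tendsto_comp_count_cellRing q r x (X ω))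

/-- A pointwise limit of functions that are constant on cells; joint measurability in `(ω, x)` is
not needed. -/
theorem measurable_lintegral_comp_neighbourCount [IsProbabilityMeasure P]
    (hX : IsPoissonProcess P X Λ) {q : ℕ → ℝ≥0∞} (hq : ∀ n, q n ≤ 1) (r : ℝ) :
    Measurable fun x => ∫⁻ ω, q ((X ω).neighbourCount r x) ∂P :=
  measurable_of_tendsto_metrizable
    (fun n => measurable_comp_cellIndex n fun k => ∫⁻ ω, q ((X ω).count (cellRing r n k)) ∂P)
    (tendsto_pi_nhds.2 fun x => hX.tendsto_lintegral_comp_count_cellRing hq r x)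

/-- The Mecke formula for functions of a point and of its neighbour count. -/
theorem lintegral_setLIntegral_comp_neighbourCount [IsProbabilityMeasure P]
    (hX : IsPoissonProcess P X Λ) {q : ℕ → ℝ≥0∞} (hq : ∀ n, q n ≤ 1) (r : ℝ)
    {B : Set (EuclideanSpace ℝ (Fin d))} (hB : MeasurableSet B) (hb : Bornology.IsBounded B) :
    ∫⁻ ω, ∫⁻ x in B, q ((X ω).neighbourCount r x) ∂(X ω).1 ∂P =
      ∫⁻ x in B, ∫⁻ ω, q ((X ω).neighbourCount r x) ∂P ∂Λ := by
  have h1 : Tendsto (fun n => ∫⁻ ω, ∫⁻ x in B,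
      q ((X ω).count (cellRing r n (cellIndex n x))) ∂(X ω).1 ∂P) atTop
      (𝓝 (∫⁻ ω, ∫⁻ x in B, q ((X ω).neighbourCount r x) ∂(X ω).1 ∂P)) := by
    -- Since `q ≤ 1`, the inner integrals are dominated by the number of points in `B`, whose mean
    -- `Λ B` is finite.
    refine tendsto_lintegral_of_dominated_convergence (fun ω => (X ω).1 B) (fun n => ?_)
      (fun n => Eventually.of_forall fun ω => setLIntegral_comp_count_le hq _ B _)
      (by simpa [hX.lintegral_apply hB hb] using hX.apply_ne_top hB hb)
      (Eventually.of_forall fun ω => tendsto_setLIntegral_comp_count_cellRing hq r hB hb (X ω))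
    simp_rw [fun ω => setLIntegral_comp_cellIndex n (X ω).1 hB
      fun k => q ((X ω).count (cellRing r n k))]
    exact Measurable.tsum fun k => (hX.measurable_apply (hB.inter (measurableSet_cell n k))).mul
      (hX.measurable_comp_count q (measurableSet_cellRing r n k))
  have h2 : Tendsto (fun n => ∫⁻ x in B, ∫⁻ ω,
      q ((X ω).count (cellRing r n (cellIndex n x))) ∂P ∂Λ) atTop
      (𝓝 (∫⁻ x in B, ∫⁻ ω, q ((X ω).neighbourCount r x) ∂P ∂Λ)) :=
    tendsto_lintegral_of_dominated_convergence (fun _ => 1)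
      (fun n => measurable_comp_cellIndex n fun k => ∫⁻ ω, q ((X ω).count (cellRing r n k)) ∂P)
      (fun n => Eventually.of_forall fun x => (lintegral_mono fun _ => hq _).trans (by simp))
      (by simpa using hX.apply_ne_top hB hb)
      (Eventually.of_forall fun x => hX.tendsto_lintegral_comp_count_cellRing hq r x)
  refine tendsto_nhds_unique h1 (h2.congr fun n => ?_)
  exact (hX.lintegral_setLIntegral_comp_count_cellRing q r n hB hb).symm

end IsPoissonProcess

/-! ### Measurability of the thinning and integration over the marks -/

namespace UniformMarking

variable {d : ℕ} {Ω : Type*} [MeasurableSpace Ω] {P : Measure Ω} {X : Ω → PointConfiguration d}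

theorem measurableSet_natCast_lt (k : ℕ) : MeasurableSet {n : ℕ∞ | (k : ℕ∞) < n} :=
  MeasurableSet.of_discrete

/-- The number of points other than the `k`-th one in the closed ball of radius `r` around the
`k`-th point, as a function of an enumeration of points. -/
noncomputable def enumNeighbourCount (r : ℝ) (k : ℕ)
    (z : ℕ∞ × (ℕ → EuclideanSpace ℝ (Fin d))) : ℕ :=
  ⌊(∑' j : ℕ, {z : ℕ∞ × (ℕ → EuclideanSpace ℝ (Fin d)) |
    (j : ℕ∞) < z.1 ∧ dist (z.2 j) (z.2 k) ≤ r ∧ z.2 j ≠ z.2 k}.indicator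
      (1 : ℕ∞ × (ℕ → EuclideanSpace ℝ (Fin d)) → ℝ≥0∞) z).toReal⌋₊

theorem measurable_enumNeighbourCount (r : ℝ) (k : ℕ) :
    Measurable (enumNeighbourCount (d := d) r k) := by
  refine Nat.measurable_floor.comp (Measurable.ennreal_toReal (Measurable.tsum fun j => ?_))
  refine measurable_one.indicator ?_
  have hj : Measurable fun z : ℕ∞ × (ℕ → EuclideanSpace ℝ (Fin d)) => z.2 j :=
    (measurable_pi_apply j).comp measurable_snd
  have hk : Measurable fun z : ℕ∞ × (ℕ → EuclideanSpace ℝ (Fin d)) => z.2 k :=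
    (measurable_pi_apply k).comp measurable_snd
  exact (measurable_fst (measurableSet_natCast_lt j)).inter
    ((measurableSet_le (hj.dist hk) measurable_const).inter (measurableSet_eq_fun hj hk).compl)

/-- The enumeration of the points of a marked point process. -/
def enum (M : UniformMarking P X) (ω : Ω) : ℕ∞ × (ℕ → EuclideanSpace ℝ (Fin d)) :=
  (M.card ω, fun k => M.point k ω)

theorem measurable_enum (M : UniformMarking P X) : Measurable M.enum :=
  M.measurable_card.prodMk (measurable_pi_lambda _ M.measurable_point)

theorem lintegral_eq_tsum (M : UniformMarking P X) (ω : Ω)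
    (f : EuclideanSpace ℝ (Fin d) → ℝ≥0∞) :
    ∫⁻ x, f x ∂(X ω).1 = ∑' k : ℕ, {k : ℕ | (k : ℕ∞) < M.card ω}.indicator
      (fun k => f (M.point k ω)) k := by
  rw [M.eq_sum ω, lintegral_sum_measure, ← tsum_subtype]
  simp_rw [lintegral_dirac]
  rfl

/-- This makes the retention threshold a measurable function of the enumeration alone, hence
independent of the marks. -/
theorem enumNeighbourCount_enum (M : UniformMarking P X) (r : ℝ) (k : ℕ) (ω : Ω) :
    enumNeighbourCount r k (M.enum ω) = (X ω).neighbourCount r (M.point k ω) := by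
  have hm : MeasurableSet (Metric.closedBall (M.point k ω) r \ {M.point k ω}) :=
    measurableSet_closedBall.diff (measurableSet_singleton _)
  rw [PointConfiguration.neighbourCount, PointConfiguration.count, enumNeighbourCount,
    ← lintegral_indicator_one hm, M.lintegral_eq_tsum]
  congr 3 with j
  classical
  simp only [Set.indicator_apply, enum, Set.mem_ofPred_eq, Set.mem_sdiff, Metric.mem_closedBall,
    Set.mem_singleton_iff, Pi.one_apply, ite_and]

theorem measurableSet_retained (M : UniformMarking P X) (r : ℝ) (p : ℕ → ℝ) (k : ℕ) :
    MeasurableSet {ω | M.Retained r p ω k} := by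
  simp_rw [Retained, ← enumNeighbourCount_enum]
  exact (M.measurable_card (measurableSet_natCast_lt k)).inter
    (measurableSet_le (M.measurable_mark k) (measurable_from_nat.comp
      ((measurable_enumNeighbourCount r k).comp M.measurable_enum)))

theorem thinning_apply (M : UniformMarking P X) (r : ℝ) (p : ℕ → ℝ) (ω : Ω)
    {A : Set (EuclideanSpace ℝ (Fin d))} (hA : MeasurableSet A) :
    (M.thinning r p ω).1 A =
      ∑' k, {ω | M.Retained r p ω k ∧ M.point k ω ∈ A}.indicator (1 : Ω → ℝ≥0∞) ω := by
  change M.thinningMeasure r p ω A = _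
  rw [thinningMeasure, Measure.sum_apply _ hA]
  refine (tsum_subtype {k | M.Retained r p ω k} fun k => Measure.dirac (M.point k ω) A).trans ?_
  refine tsum_congr fun k => ?_
  classical
  simp only [Set.indicator_apply, Set.mem_ofPred_eq, Measure.dirac_apply' _ hA, Pi.one_apply,
    ite_and]

theorem measurableSet_retained_mem (M : UniformMarking P X) (r : ℝ) (p : ℕ → ℝ) (k : ℕ)
    {A : Set (EuclideanSpace ℝ (Fin d))} (hA : MeasurableSet A) :
    MeasurableSet {ω | M.Retained r p ω k ∧ M.point k ω ∈ A} :=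
  (M.measurableSet_retained r p k).inter (M.measurable_point k hA)

theorem measurable_thinning (M : UniformMarking P X) (r : ℝ) (p : ℕ → ℝ) :
    Measurable (M.thinning r p) := by
  refine (Measure.measurable_of_measurable_coe _ fun A hA => ?_).subtype_mk
  simp_rw [show ∀ ω, M.thinningMeasure r p ω A = _ from fun ω => M.thinning_apply r p ω hA]
  exact Measurable.tsum fun k => measurable_one.indicator (M.measurableSet_retained_mem r p k hA)

/-- The marks may be integrated out: the expected number of retained points in `B` is the expected
sum of the retention probabilities of the points in `B`. -/
theorem lintegral_thinning_apply [IsProbabilityMeasure P] (M : UniformMarking P X) (r : ℝ)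
    {p : ℕ → ℝ} (hp : ∀ n, p n ∈ Set.Icc (0 : ℝ) 1)
    {B : Set (EuclideanSpace ℝ (Fin d))} (hB : MeasurableSet B) :
    ∫⁻ ω, (M.thinning r p ω).1 B ∂P =
      ∫⁻ ω, ∫⁻ x in B, ENNReal.ofReal (p ((X ω).neighbourCount r x)) ∂(X ω).1 ∂P := by
  classical
  have hS (k : ℕ) : MeasurableSet {z : ℕ∞ × (ℕ → EuclideanSpace ℝ (Fin d)) |
      (k : ℕ∞) < z.1 ∧ z.2 k ∈ B} :=
    (measurable_fst (measurableSet_natCast_lt k)).inter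
      (((measurable_pi_apply k).comp measurable_snd) hB)
  have ha (k : ℕ) : Measurable ({z : ℕ∞ × (ℕ → EuclideanSpace ℝ (Fin d)) |
      (k : ℕ∞) < z.1 ∧ z.2 k ∈ B}.indicator (1 : ℕ∞ × (ℕ → EuclideanSpace ℝ (Fin d)) → ℝ≥0∞)) := measurable_one.indicator (hS k)
  have hn (k : ℕ) := measurable_enumNeighbourCount (d := d) r k
  simp_rw [fun ω => M.thinning_apply r p ω hB, ← lintegral_indicator hB, M.lintegral_eq_tsum]
  rw [lintegral_tsum fun k => (measurable_one.indicator
    (M.measurableSet_retained_mem r p k hB)).aemeasurable]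
  -- By linearity only one mark at a time matters: the `k`-th mark is independent of the whole
  -- enumeration.
  have key (k : ℕ) := lintegral_indicator_uniform_le M.measurable_enum (M.measurable_mark k)
    (M.law_mark k) (M.indepFun.comp measurable_id (measurable_pi_apply k)) hp (ha k) (hn k)
  have he (k : ℕ) (ω : Ω) :
      {z : ℕ∞ × (ℕ → EuclideanSpace ℝ (Fin d)) | (k : ℕ∞) < z.1 ∧ z.2 k ∈ B}.indicator
        (1 : ℕ∞ × (ℕ → EuclideanSpace ℝ (Fin d)) → ℝ≥0∞) (M.enum ω) =
      if (k : ℕ∞) < M.card ω ∧ M.point k ω ∈ B then 1 else 0 := by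
    split_ifs with h
    · exact Set.indicator_of_mem (show M.enum ω ∈ {z | _} from h) _
    · exact Set.indicator_of_notMem (show M.enum ω ∉ {z | _} from h) _
  have hl (k : ℕ) (ω : Ω) :
      {ω | M.Retained r p ω k ∧ M.point k ω ∈ B}.indicator (1 : Ω → ℝ≥0∞) ω =
      {z : ℕ∞ × (ℕ → EuclideanSpace ℝ (Fin d)) | (k : ℕ∞) < z.1 ∧ z.2 k ∈ B}.indicator 1
        (M.enum ω) *
      {ω | M.mark k ω ≤ p (enumNeighbourCount r k (M.enum ω))}.indicator 1 ω := by
    rw [he]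
    simp only [enumNeighbourCount_enum, Set.indicator_apply, Set.mem_ofPred_eq, Retained,
      Pi.one_apply, ite_and]
    split_ifs <;> simp
  have hr (k : ℕ) (ω : Ω) :
      {k : ℕ | (k : ℕ∞) < M.card ω}.indicator (fun k => B.indicator
        (fun x => ENNReal.ofReal (p ((X ω).neighbourCount r x))) (M.point k ω)) k =
      {z : ℕ∞ × (ℕ → EuclideanSpace ℝ (Fin d)) | (k : ℕ∞) < z.1 ∧ z.2 k ∈ B}.indicator 1
        (M.enum ω) * ENNReal.ofReal (p (enumNeighbourCount r k (M.enum ω))) := by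
    rw [he]
    simp only [enumNeighbourCount_enum, Set.indicator_apply, Set.mem_ofPred_eq, ite_and]
    split_ifs <;> simp
  simp_rw [hr, hl]
  have hm (k : ℕ) : Measurable fun ω =>
      {z : ℕ∞ × (ℕ → EuclideanSpace ℝ (Fin d)) | (k : ℕ∞) < z.1 ∧ z.2 k ∈ B}.indicator
        (1 : ℕ∞ × (ℕ → EuclideanSpace ℝ (Fin d)) → ℝ≥0∞) (M.enum ω) * ENNReal.ofReal (p (enumNeighbourCount r k (M.enum ω))) :=
    ((ha k).comp M.measurable_enum).mul (measurable_from_nat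
      (f := fun n => ENNReal.ofReal (p n)) |>.comp ((hn k).comp M.measurable_enum))
  rw [lintegral_tsum fun k => (hm k).aemeasurable]
  exact tsum_congr key

end UniformMarking

/-! ### The Poisson mean and its series -/

section PoissonMean

variable {p : ℕ → ℝ}

theorem integrable_poissonMeasure_of_mem_Icc (hp : ∀ n, p n ∈ Set.Icc (0 : ℝ) 1) (m : ℝ≥0) :
    Integrable p (poissonMeasure m) :=
  Integrable.of_bound measurable_from_nat.aestronglyMeasurable 1 (Eventually.of_forall fun n => by
    rw [Real.norm_of_nonneg (hp n).1]
    exact (hp n).2)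

theorem poissonMean_nonneg (hp : ∀ n, p n ∈ Set.Icc (0 : ℝ) 1) (t : ℝ) : 0 ≤ poissonMean p t :=
  integral_nonneg fun n => (hp n).1

theorem poissonMean_le_one (hp : ∀ n, p n ∈ Set.Icc (0 : ℝ) 1) (t : ℝ) : poissonMean p t ≤ 1 :=
  (integral_mono (integrable_poissonMeasure_of_mem_Icc hp _) (integrable_const 1)
    fun n => (hp n).2).trans (by simp)

theorem ofReal_poissonMean (hp : ∀ n, p n ∈ Set.Icc (0 : ℝ) 1) (t : ℝ) :
    ENNReal.ofReal (poissonMean p t) =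
      ∫⁻ n, ENNReal.ofReal (p n) ∂(poissonMeasure t.toNNReal) :=
  ofReal_integral_eq_lintegral_ofReal (integrable_poissonMeasure_of_mem_Icc hp _)
    (Eventually.of_forall fun n => (hp n).1)

theorem summable_mul_pow_div_factorial (hp : ∀ n, p n ∈ Set.Icc (0 : ℝ) 1) {t : ℝ} (ht : 0 ≤ t) :
    Summable fun n : ℕ => p n * t ^ n / (n.factorial : ℝ) := by
  refine Summable.of_nonneg_of_le (fun n => ?_) (fun n => ?_) (Real.summable_pow_div_factorial t)
  · have := (hp n).1
    positivity
  · rw [mul_div_assoc]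
    exact mul_le_of_le_one_left (by positivity) (hp n).2

theorem poissonMean_eq_exp_mul_tsum (p : ℕ → ℝ) {t : ℝ} (ht : 0 ≤ t) :
    poissonMean p t = Real.exp (-t) * ∑' n : ℕ, p n * t ^ n / (n.factorial : ℝ) := by
  rw [poissonMean, integral_poissonMeasure, ← tsum_mul_left, Real.coe_toNNReal t ht]
  refine tsum_congr fun n => ?_
  rw [smul_eq_mul]
  ring

end PoissonMean

/-! ### The intensity of the thinned process -/

section Intensity

variable {d : ℕ} {lam : EuclideanSpace ℝ (Fin d) → ℝ}

theorem ballMass_nonneg (hlam_nonneg : ∀ x, 0 ≤ lam x) (r : ℝ) (x : EuclideanSpace ℝ (Fin d)) :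
    0 ≤ ballMass lam r x :=
  integral_nonneg hlam_nonneg

theorem withDensity_puncturedBall (hd : 1 ≤ d) (hlam_nonneg : ∀ x, 0 ≤ lam x)
    (hlam : LocallyIntegrable lam volume) (r : ℝ) (x : EuclideanSpace ℝ (Fin d)) :
    volume.withDensity (fun x => ENNReal.ofReal (lam x)) (Metric.closedBall x r \ {x}) =
      ENNReal.ofReal (ballMass lam r x) := by
  -- Here `d ≥ 1` enters: it makes singletons Lebesgue null, so removing the centre costs no mass.
  have : Nonempty (Fin d) := ⟨⟨0, hd⟩⟩
  rw [measure_sdiff_null (withDensity_absolutelyContinuous _ _ (measure_singleton x)),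
    withDensity_apply _ measurableSet_closedBall, ballMass,
    ofReal_integral_eq_lintegral_ofReal
      (hlam.integrableOn_isCompact (isCompact_closedBall x r))
      (Eventually.of_forall hlam_nonneg)]

theorem MeasureTheory.LocallyIntegrable.integrableOn_of_isBounded (hlam : LocallyIntegrable lam volume)
    {B : Set (EuclideanSpace ℝ (Fin d))} (hb : Bornology.IsBounded B) : IntegrableOn lam B volume :=
  (hlam.integrableOn_isCompact hb.isCompact_closure).mono_set subset_closure

variable {Ω : Type*} [MeasurableSpace Ω] {P : Measure Ω}
  {X : Ω → PointConfiguration d} {p : ℕ → ℝ}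

theorem IsPoissonProcess.lintegral_ofReal_neighbourCount (hd : 1 ≤ d)
    (hlam_nonneg : ∀ x, 0 ≤ lam x) (hlam : LocallyIntegrable lam volume)
    (hX : IsPoissonProcess P X (volume.withDensity fun x => ENNReal.ofReal (lam x)))
    (hp : ∀ n, p n ∈ Set.Icc (0 : ℝ) 1) (r : ℝ) (x : EuclideanSpace ℝ (Fin d)) :
    ∫⁻ ω, ENNReal.ofReal (p ((X ω).neighbourCount r x)) ∂P =
      ENNReal.ofReal (poissonMean p (ballMass lam r x)) := by
  obtain ⟨m, hm, hlaw⟩ := hX.law (Metric.closedBall x r \ {x})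
    (measurableSet_closedBall.diff (measurableSet_singleton x))
    (Metric.isBounded_closedBall.subset Set.sdiff_subset)
  -- This identifies the Poisson parameter `m` with `(ballMass lam r x).toNNReal`, the one used in
  -- `poissonMean`.
  rw [withDensity_puncturedBall hd hlam_nonneg hlam, ENNReal.ofReal, ENNReal.coe_inj] at hm
  rw [ofReal_poissonMean hp, hm]
  exact hlaw.lintegral_comp (f := fun n => ENNReal.ofReal (p n)) measurable_from_nat.aemeasurable

variable [IsProbabilityMeasure P]

/-- Measurability in `x` is read off from the process: the function is the mean of `p (n_r(x; X))`.
-/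
theorem IsPoissonProcess.measurable_poissonMean_ballMass (hd : 1 ≤ d)
    (hlam_nonneg : ∀ x, 0 ≤ lam x) (hlam : LocallyIntegrable lam volume)
    (hX : IsPoissonProcess P X (volume.withDensity fun x => ENNReal.ofReal (lam x)))
    (hp : ∀ n, p n ∈ Set.Icc (0 : ℝ) 1) (r : ℝ) :
    Measurable fun x => poissonMean p (ballMass lam r x) := by
  have h := hX.measurable_lintegral_comp_neighbourCount (q := fun n => ENNReal.ofReal (p n))
    (fun n => ENNReal.ofReal_le_one.2 (hp n).2) r
  simp_rw [hX.lintegral_ofReal_neighbourCount hd hlam_nonneg hlam hp r] at h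
  simpa only [ENNReal.toReal_ofReal (poissonMean_nonneg hp _)] using h.ennreal_toReal

theorem IsPoissonProcess.integrableOn_mul_poissonMean (hd : 1 ≤ d)
    (hlam_nonneg : ∀ x, 0 ≤ lam x) (hlam : LocallyIntegrable lam volume)
    (hX : IsPoissonProcess P X (volume.withDensity fun x => ENNReal.ofReal (lam x)))
    (hp : ∀ n, p n ∈ Set.Icc (0 : ℝ) 1) (r : ℝ) {B : Set (EuclideanSpace ℝ (Fin d))}
    (hb : Bornology.IsBounded B) :
    IntegrableOn (fun x => lam x * poissonMean p (ballMass lam r x)) B volume := by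
  refine Integrable.mul_bdd (c := 1) (hlam.integrableOn_of_isBounded hb)
    (hX.measurable_poissonMean_ballMass hd hlam_nonneg hlam hp r).aestronglyMeasurable
    (Eventually.of_forall fun x => ?_)
  rw [Real.norm_of_nonneg (poissonMean_nonneg hp _)]
  exact poissonMean_le_one hp _

theorem UniformMarking.intensityMeasure_thinning_apply (hd : 1 ≤ d)
    (hlam_nonneg : ∀ x, 0 ≤ lam x) (hlam : LocallyIntegrable lam volume)
    (hX : IsPoissonProcess P X (volume.withDensity fun x => ENNReal.ofReal (lam x)))
    (M : UniformMarking P X) (hp : ∀ n, p n ∈ Set.Icc (0 : ℝ) 1) (r : ℝ)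
    {B : Set (EuclideanSpace ℝ (Fin d))} (hB : MeasurableSet B) (hb : Bornology.IsBounded B) :
    intensityMeasure P (M.thinning r p) B =
      ∫⁻ x in B, ENNReal.ofReal (lam x * poissonMean p (ballMass lam r x)) := by
  rw [intensityMeasure_apply P (M.measurable_thinning r p) hB, M.lintegral_thinning_apply r hp hB,
    hX.lintegral_setLIntegral_comp_neighbourCount (q := fun n => ENNReal.ofReal (p n))
      (fun n => ENNReal.ofReal_le_one.2 (hp n).2) r hB hb]
  simp_rw [hX.lintegral_ofReal_neighbourCount hd hlam_nonneg hlam hp r]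
  rw [setLIntegral_withDensity_eq_lintegral_mul₀
    hlam.aestronglyMeasurable.aemeasurable.ennreal_ofReal
    (hX.measurable_poissonMean_ballMass hd hlam_nonneg hlam hp r).ennreal_ofReal.aemeasurable hB]
  exact lintegral_congr fun x => (ENNReal.ofReal_mul (hlam_nonneg x)).symm

end Intensity

theorem mainTheorem5 {d : ℕ} (hd : 1 ≤ d) {Ω : Type*} [MeasurableSpace Ω]
    (P : Measure Ω) [IsProbabilityMeasure P]
    (lam : EuclideanSpace ℝ (Fin d) → ℝ) (hlam_nonneg : ∀ x, 0 ≤ lam x)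
    (hlam : LocallyIntegrable lam volume)
    (X : Ω → PointConfiguration d)
    (hX : IsPoissonProcess P X (volume.withDensity fun x => ENNReal.ofReal (lam x)))
    (M : UniformMarking P X) (r : ℝ) (hr : 0 < r)
    (p : ℕ → ℝ) (hp : ∀ n, p n ∈ Set.Icc (0 : ℝ) 1) :
    Measurable (M.thinning r p) ∧
    (∀ B : Set (EuclideanSpace ℝ (Fin d)), MeasurableSet B → Bornology.IsBounded B →
      IntegrableOn (fun x => lam x * poissonMean p (ballMass lam r x)) B volume ∧
      intensityMeasure P (M.thinning r p) B =
        ENNReal.ofReal (∫ x in B, lam x * poissonMean p (ballMass lam r x))) ∧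
    intensityMeasure P (M.thinning r p) =
      volume.withDensity
        (fun x => ENNReal.ofReal (lam x * poissonMean p (ballMass lam r x))) ∧
    (∀ x, Summable (fun n : ℕ => p n * ballMass lam r x ^ n / (n.factorial : ℝ)) ∧
      lam x * poissonMean p (ballMass lam r x) =
        lam x * (Real.exp (-ballMass lam r x) *
          ∑' n : ℕ, p n * ballMass lam r x ^ n / (n.factorial : ℝ))) := by
  refine ⟨M.measurable_thinning r p, fun B hB hb => ?_, ?_, fun x => ?_⟩
  · have hint := hX.integrableOn_mul_poissonMean hd hlam_nonneg hlam hp r hb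
    refine ⟨hint, ?_⟩
    rw [M.intensityMeasure_thinning_apply hd hlam_nonneg hlam hX hp r hB hb,
      ofReal_integral_eq_lintegral_ofReal hint (Eventually.of_forall fun x =>
        mul_nonneg (hlam_nonneg x) (poissonMean_nonneg hp _))]
  -- The formula is known on bounded sets only, so the measures are compared on the balls of radius
  -- `n` about the origin, which exhaust space.
  · refine Measure.ext_of_iUnion_eq_univ (Metric.iUnion_closedBall_nat 0) fun n => ?_
    refine Measure.ext fun B hB => ?_
    have hBn := hB.inter (measurableSet_closedBall (x := (0 : EuclideanSpace ℝ (Fin d))) (ε := n))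
    rw [Measure.restrict_apply hB, Measure.restrict_apply hB, withDensity_apply _ hBn,
      M.intensityMeasure_thinning_apply hd hlam_nonneg hlam hX hp r hBn
        (Metric.isBounded_closedBall.subset Set.inter_subset_right)]
  · have h0 := ballMass_nonneg hlam_nonneg r x
    exact ⟨summable_mul_pow_div_factorial hp h0, by rw [poissonMean_eq_exp_mul_tsum p h0]⟩
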